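/- Let $G$ be a finite simple graph with $n\ge 1$ vertices, all of whose degrees $d_1,\dots,d_n$ are even. An Eulerian orientation of $G$ is an orientation of its edges for which every vertex has equal in-degree and out-degree; let $\operatorname{EO}(G)$ be the number of Eulerian orientations of $G$, and put \[ \rho(G)=\frac1n\log\operatorname{EO}(G),\qquad \widehat\rho(G)=\frac1n\sum_{i=1}^n\Bigl(\log\binom{d_i}{d_i/2}-\frac{d_i}{2}\log 2\Bigr). \] Then \[ \widehat\rho(G)\le\rho(G)\le\widehat\rho(G)+\frac{27}{10}. \] If moreover $G$ is regular, then $\rho(G)\le\widehat\rho(G)+\frac{21}{22}$, and if $G$ is regular and has no 3-cycles, then $\rho(G)\le\widehat\rho(G)+\frac56$. Finally, there is an absolute constant $C$ such that every such $G$ with minimum degree $d_{\min}\ge 2$ satisfies \[ \widehat\rho(G)\le\rho(G)\le\widehat\rho(G)+\log 2+C\,\frac{\log^2 d_{\min}}{d_{\min}}; \] in particular, if $d_{\min}=d_{\min}(n)\to\infty$, then $\rho(G)\le\widehat\rho(G)+\log 2+O\bigl(\log^2 d_{\min}/d_{\min}\bigr)$. -/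

import Mathlib

universe u

namespace EulerianOrientation

/-- `D` is an Eulerian orientation of the simple graph `G`: every edge `{v, w}` of `G` is given
exactly one of the directions `v → w`, `w → v`, the digraph `D` has no other arcs, and at every
vertex the in-degree equals the out-degree. -/
structure IsEulerianOrientation {V : Type u} (G : SimpleGraph V) (D : Digraph V) : Prop where
  adj_of_arc : ∀ v w : V, D.Adj v w → G.Adj v w
  xor_of_adj : ∀ v w : V, G.Adj v w → Xor (D.Adj v w) (D.Adj w v)
  balanced : ∀ v : V, {w : V | D.Adj w v}.ncard = {w : V | D.Adj v w}.ncard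

/-- The number `EO(G)` of Eulerian orientations of `G`. -/
noncomputable def EO {V : Type u} (G : SimpleGraph V) : ℕ :=
  {D : Digraph V | IsEulerianOrientation G D}.ncard

/-- The residual entropy `ρ(G) = (1/n) log EO(G)`, where `n` is the number of vertices. -/
noncomputable def rho {V : Type u} [Fintype V] (G : SimpleGraph V) : ℝ :=
  1 / (Fintype.card V : ℝ) * Real.log (EO G : ℝ)

/-- The Pauling estimate: the average over the vertices `v`, of degree `d`, of
`log (d choose d/2) - (d/2) log 2`. -/
noncomputable def pauling {V : Type u} [Fintype V] (G : SimpleGraph V) [DecidableRel G.Adj] : ℝ :=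
  1 / (Fintype.card V : ℝ) *
    ∑ v : V, (Real.log ((G.degree v).choose (G.degree v / 2) : ℝ)
      - (G.degree v : ℝ) / 2 * Real.log 2)

end EulerianOrientation

/-! Both bounds are counting arguments, and together they place `rho G - pauling G` in `[0, log 2]`;
all the stated constants follow.

Lower bound (Schrijver): pair up the edges at every vertex. Following edges and pairs alternately
cuts the graph into closed trails; directing each trail gives an Eulerian orientation in which every
pair has one edge in and one out. At a vertex of degree `2m` there are `(2m)!` labelled pairings,
and a fixed orientation is compatible with at most `2^m * m!^2` of them. Hence `EO G` is at least
the product of `(2m choose m) / 2^m`.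

Upper bound: reveal the orientation vertex by vertex in some order. Once the earlier vertices are
treated, the number of out-arcs to later neighbours is forced, so a vertex with `k` later neighbours
has at most `k.choose (k / 2)` continuations. In a uniformly random order `k` is uniform on `0, ...,
d`; averaging the logarithms gives `log_EO_le`. The average is within `log 2` of the Pauling term by
`sum_log_choose_half_le`. -/

open Finset

/-! ### Lower bound: edge pairings and closed trails -/

/-- Two fixed-point-free involutions of a type admit a common `2`-colouring which both of them
flip. -/
theorem Equiv.Perm.exists_flipped_by_involutions {X : Type*} (a b : Equiv.Perm X)
    (ha : a * a = 1) (hb : b * b = 1) (ha' : ∀ x, a x ≠ x) (hb' : ∀ x, b x ≠ x) :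
    ∃ o : X → Prop, (∀ x, o (a x) ↔ ¬ o x) ∧ ∀ x, o (b x) ↔ ¬ o x := by
  classical
  set g : Equiv.Perm X := b * a with hg
  have hai : a⁻¹ = a := inv_eq_of_mul_eq_one_left ha
  have hbi : b⁻¹ = b := inv_eq_of_mul_eq_one_left hb
  have hconj : ∀ i : ℤ, a * g ^ i = g ^ (-i) * a := by
    intro i
    have h1 : a * g * a⁻¹ = g⁻¹ := by
      rw [hg, mul_inv_rev, hai, hbi, mul_assoc, mul_assoc, ha, mul_one]
    have h2 : (a * g * a⁻¹) ^ i = a * g ^ i * a⁻¹ := conj_zpow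
    rw [h1, inv_zpow] at h2
    rw [zpow_neg, h2, inv_mul_cancel_right]
  have hb_eq : b = g * a := by rw [hg, mul_assoc, ha, mul_one]
  -- By the dihedral relation `hconj`, if `g ^ i` sends `x` to `a x`, then the midpoint of the path
  -- is fixed: by `a` when `i = 2 * j`, by `b` when `i = 2 * j + 1`.
  have hne : ∀ x, ¬ g.SameCycle x (a x) := by
    rintro x ⟨i, hi⟩
    obtain ⟨j, rfl | rfl⟩ := Int.even_or_odd' i
    · refine ha' ((g ^ j) x) ?_
      calc a ((g ^ j) x) = (a * g ^ j) x := rfl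
        _ = (g ^ (-j) * g ^ (2 * j)) x := by
          rw [hconj, Equiv.Perm.mul_apply, Equiv.Perm.mul_apply, hi]
        _ = (g ^ j) x := by rw [← zpow_add]; congr 2; ring
    · refine hb' ((g ^ (j + 1)) x) ?_
      calc b ((g ^ (j + 1)) x) = (g * (a * g ^ (j + 1))) x := by rw [hb_eq]; rfl
        _ = (g * (g ^ (-(j + 1)) * g ^ (2 * j + 1))) x := by
          rw [hconj, Equiv.Perm.mul_apply g, Equiv.Perm.mul_apply g,
            Equiv.Perm.mul_apply (g ^ (-(j + 1))) a,
            Equiv.Perm.mul_apply (g ^ (-(j + 1))) (g ^ (2 * j + 1)), hi]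
        _ = (g ^ (j + 1)) x := by
          rw [← zpow_add, ← zpow_one_add]; congr 2; ring
  have hmap : ∀ x y, g.SameCycle x y → g.SameCycle (a x) (a y) := by
    rintro x y ⟨i, rfl⟩
    exact ⟨-i, by rw [← Equiv.Perm.mul_apply, ← hconj, Equiv.Perm.mul_apply]⟩
  let s : Setoid X := Equiv.Perm.SameCycle.setoid g
  let f : Quotient s → Quotient s := Quotient.map a hmap
  have hf : ∀ q, f (f q) = q := by
    intro q
    induction q using Quotient.inductionOn with
    | h x =>
      change (⟦a (a x)⟧ : Quotient s) = ⟦x⟧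
      rw [← Equiv.Perm.mul_apply, ha, Equiv.Perm.one_apply]
  have hf' : ∀ q, f q ≠ q := by
    intro q
    induction q using Quotient.inductionOn with
    | h x => exact fun h => hne x (Quotient.exact h).symm
  -- `f` matches the cycles of `g` in pairs. An arbitrary linear order selects one cycle of each
  -- pair to colour. Since `b = g * a`, the map `b` induces the same `f`.
  let : LinearOrder (Quotient s) := IsWellOrder.linearOrder WellOrderingRel
  have hflip : ∀ q, f q < f (f q) ↔ ¬ q < f q := by
    intro q
    rw [hf, not_lt]
    exact ⟨le_of_lt, fun h => lt_of_le_of_ne h (hf' q)⟩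
  refine ⟨fun x => (⟦x⟧ : Quotient s) < f ⟦x⟧, fun x => hflip ⟦x⟧, fun x => ?_⟩
  have hbx : (⟦b x⟧ : Quotient s) = f ⟦x⟧ :=
    Quotient.sound (s := s) (Equiv.Perm.SameCycle.symm ⟨1, by rw [zpow_one, hb_eq]; rfl⟩)
  beta_reduce
  rw [hbx]
  exact hflip ⟦x⟧

/-- Enumerations of a set of size `2 * m` in `m` pairs, each pair containing exactly one element of
a subset `p` of size `m`. -/
theorem card_splitting_enumerations_le {X : Type*} [Fintype X] [DecidableEq X] (m : ℕ)
    (p : X → Prop) [DecidablePred p] (hp : Fintype.card {x // p x} = m)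
    (hq : Fintype.card {x // ¬ p x} = m) :
    Fintype.card {e : (Fin m × Bool) ≃ X // ∀ i, p (e (i, true)) ↔ ¬ p (e (i, false))} ≤
      2 ^ m * (m.factorial * m.factorial) := by
  classical
  let c : {e : (Fin m × Bool) ≃ X // ∀ i, p (e (i, true)) ↔ ¬ p (e (i, false))} →
      Fin m → Bool := fun e i => decide (p (e.1 (i, true)))
  have h1 : ∀ (e : {e : (Fin m × Bool) ≃ X // ∀ i, p (e (i, true)) ↔ ¬ p (e (i, false))}) i,
      p (e.1 (i, c e i)) := by
    intro e i
    by_cases h : p (e.1 (i, true))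
    · simp [c, h]
    · have := e.2 i
      simp only [c, h, decide_false]
      tauto
  have h2 : ∀ (e : {e : (Fin m × Bool) ≃ X // ∀ i, p (e (i, true)) ↔ ¬ p (e (i, false))}) i,
      ¬ p (e.1 (i, !c e i)) := by
    intro e i
    by_cases h : p (e.1 (i, true))
    · have := e.2 i
      simp only [c, h, decide_true, Bool.not_true]
      tauto
    · simp [c, h]
  -- An enumeration is recovered from the position of the `p`-element in each pair and the two
  -- resulting lists of elements, inside and outside `p`.
  let F : {e : (Fin m × Bool) ≃ X // ∀ i, p (e (i, true)) ↔ ¬ p (e (i, false))} →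
      (Fin m → Bool) × (Fin m ↪ {x // p x}) × (Fin m ↪ {x // ¬ p x}) := fun e =>
    (c e, ⟨fun i => ⟨e.1 (i, c e i), h1 e i⟩, fun i j h => (Prod.ext_iff.1 (e.1.injective (Subtype.ext_iff.1 h))).1⟩,
      ⟨fun i => ⟨e.1 (i, !c e i), h2 e i⟩, fun i j h => (Prod.ext_iff.1 (e.1.injective (Subtype.ext_iff.1 h))).1⟩)
  have hF : Function.Injective F := by
    intro e e' h
    have hc : c e = c e' := congrArg Prod.fst h
    have hI : ∀ i, e.1 (i, c e i) = e'.1 (i, c e' i) := fun i =>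
      congrArg (fun t => (t.2.1 i).1) h
    have hJ : ∀ i, e.1 (i, !c e i) = e'.1 (i, !c e' i) := fun i =>
      congrArg (fun t => (t.2.2 i).1) h
    apply Subtype.ext
    apply Equiv.ext
    rintro ⟨i, t⟩
    have hI := hI i
    have hJ := hJ i
    rw [← hc] at hI hJ
    cases t <;> cases hci : c e i <;> simp_all
  refine (Fintype.card_le_of_injective F hF).trans (le_of_eq ?_)
  simp [Fintype.card_prod, Fintype.card_embedding_eq, hp, hq, Nat.descFactorial_self]

namespace EulerianOrientation

variable {V : Type u}

/-- `Set.ncard` is `0` on infinite sets, so finiteness is needed to treat `EO` as a `Finset`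
cardinality. -/
theorem finite_digraph [Finite V] : Finite (Digraph V) :=
  Finite.of_injective (fun D : Digraph V => D.Adj) fun D D' h => by
    cases D; cases D'; simpa using h

theorem IsEulerianOrientation.adj_iff {G : SimpleGraph V} {D : Digraph V}
    (hD : IsEulerianOrientation G D) (v w : V) : D.Adj w v ↔ G.Adj v w ∧ ¬ D.Adj v w := by
  constructor
  · intro h
    have hG := (hD.adj_of_arc w v h).symm
    have := hD.xor_of_adj v w hG
    refine ⟨hG, fun h' => ?_⟩
    rcases this with h'' | h'' <;> exact h''.2 (by assumption)
  · rintro ⟨hG, h⟩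
    rcases hD.xor_of_adj v w hG with h'' | h''
    · exact absurd h''.1 h
    · exact h''.1

theorem IsEulerianOrientation.card_out [Fintype V] {G : SimpleGraph V} [DecidableRel G.Adj]
    {D : Digraph V} (hD : IsEulerianOrientation G D) [DecidableRel D.Adj] (v : V) :
    2 * #{w | D.Adj v w} = G.degree v := by
  classical
  have hin := hD.balanced v
  rw [Set.ncard_eq_toFinset_card', Set.ncard_eq_toFinset_card'] at hin
  simp only [Set.toFinset_ofPred] at hin
  have hsplit : G.neighborFinset v = ({w | D.Adj v w} : Finset V) ∪ ({w | D.Adj w v} : Finset V) := by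
    ext w
    have := hD.adj_iff v w
    have := hD.adj_of_arc v w
    simp only [SimpleGraph.mem_neighborFinset, mem_union, mem_filter, mem_univ, true_and]
    tauto
  have hdisj : Disjoint ({w | D.Adj v w} : Finset V) ({w | D.Adj w v} : Finset V) := by
    rw [Finset.disjoint_left]
    intro w
    have := hD.adj_iff v w
    simp only [mem_filter, mem_univ, true_and]
    tauto
  rw [← SimpleGraph.card_neighborFinset_eq_degree, hsplit, card_union_of_disjoint hdisj, hin]
  ring

/-- If the neighbours of each vertex are grouped in pairs, there is an Eulerian orientation in which
each pair contributes one in-arc and one out-arc. -/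
theorem exists_isEulerianOrientation_of_pairing [Fintype V] (G : SimpleGraph V)
    [DecidableRel G.Adj] (m : V → ℕ) (e : ∀ v, (Fin (m v) × Bool) ≃ G.neighborSet v) :
    ∃ D : Digraph V, IsEulerianOrientation G D ∧
      ∀ v i, D.Adj v (e v (i, true)) ↔ ¬ D.Adj v (e v (i, false)) := by
  classical
  -- `X` is the set of darts. Below, `a` reverses a dart and `b` passes to its partner at the same
  -- vertex.
  let X := Σ v, G.neighborSet v
  let flip : ∀ v, Equiv.Perm (G.neighborSet v) := fun v =>
    (e v).symm.trans (((Equiv.refl _).prodCongr Equiv.boolNot).trans (e v))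
  have hflip' : ∀ v i t, flip v (e v (i, t)) = e v (i, !t) := fun v i t => by
    simp [flip, Equiv.boolNot]
  have hflip : ∀ v w, flip v (flip v w) = w := by
    intro v w
    obtain ⟨⟨i, t⟩, rfl⟩ := (e v).surjective w
    rw [hflip', hflip', Bool.not_not]
  have hflip_ne : ∀ v w, flip v w ≠ w := by
    intro v w
    obtain ⟨⟨i, t⟩, rfl⟩ := (e v).surjective w
    rw [hflip']
    simp
  have hrev : Function.Involutive
      (fun x : X => (⟨x.2.1, x.1, x.2.2.symm⟩ : X)) := fun x => rfl
  let a : Equiv.Perm X := hrev.toPerm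
  let b : Equiv.Perm X := Equiv.sigmaCongrRight flip
  obtain ⟨o, hoa, hob⟩ := Equiv.Perm.exists_flipped_by_involutions a b
    (Equiv.ext fun x => rfl)
    (Equiv.ext fun x => Sigma.ext rfl (heq_of_eq (hflip _ _)))
    (fun x h => G.ne_of_adj x.2.2 (congrArg Sigma.fst h).symm)
    (fun x h => hflip_ne x.1 x.2 (eq_of_heq (Sigma.ext_iff.1 h).2))
  have hoa' : ∀ v w (h : G.Adj v w), o ⟨w, v, h.symm⟩ ↔ ¬ o ⟨v, w, h⟩ := fun v w h =>
    hoa ⟨v, w, h⟩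
  have hob' : ∀ v w, o ⟨v, flip v w⟩ ↔ ¬ o ⟨v, w⟩ := fun v w => hob ⟨v, w⟩
  -- A coloured dart is an outgoing arc: flipping under `a` gives each edge exactly one direction,
  -- and flipping under `b` matches in-arcs with out-arcs at each vertex.
  let D : Digraph V := ⟨fun v w => ∃ h : G.Adj v w, o ⟨v, w, h⟩⟩
  have hDadj : ∀ v (w : G.neighborSet v), D.Adj v w ↔ o ⟨v, w⟩ := fun v w =>
    ⟨fun ⟨_, h⟩ => h, fun h => ⟨w.2, h⟩⟩
  refine ⟨D, ⟨fun v w h => h.1, fun v w h => ?_, fun v => ?_⟩, fun v i => ?_⟩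
  · have h1 := hDadj v ⟨w, h⟩
    have h2 := hDadj w ⟨v, h.symm⟩
    have h3 := hoa' v w h
    simp only at h1 h2
    rw [h1, h2, h3]
    by_cases h4 : o ⟨v, w, h⟩ <;> simp [h4, Xor]
  · refine Set.ncard_congr
      (fun w h => (flip v ⟨w, h.1.symm⟩ : V)) ?_ ?_ ?_
    · rintro w ⟨h, ho⟩
      exact (hDadj v _).2 ((hob' v _).2 fun h' => (hoa' w v h).1 h' ho)
    · intro w w' h h' heq
      exact congrArg Subtype.val ((flip v).injective (Subtype.ext heq))
    · rintro w ⟨h, ho⟩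
      refine ⟨flip v ⟨w, h⟩, ⟨(flip v ⟨w, h⟩).2.symm, ?_⟩, ?_⟩
      · exact (hoa' v _ (flip v ⟨w, h⟩).2).2 (by rw [hob']; exact not_not.2 ho)
      · exact congrArg Subtype.val (hflip v ⟨w, h⟩)
  · have h := hob' v (e v (i, false))
    rwa [hflip', Bool.not_false, ← hDadj, ← hDadj] at h

/-- **Schrijver's lower bound** for the number of Eulerian orientations. -/
theorem prod_factorial_le_EO_mul [Fintype V] (G : SimpleGraph V) [DecidableRel G.Adj] (m : V → ℕ)
    (hm : ∀ v, G.degree v = 2 * m v) :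
    ∏ v, (2 * m v).factorial ≤
      EO G * ∏ v, (2 ^ m v * ((m v).factorial * (m v).factorial)) := by
  classical
  have : Finite (Digraph V) := finite_digraph
  have : Fintype (Digraph V) := Fintype.ofFinite _
  let E := ∀ v, (Fin (m v) × Bool) ≃ G.neighborSet v
  let P : Digraph V → E → Prop := fun D e =>
    ∀ v i, D.Adj v (e v (i, true)) ↔ ¬ D.Adj v (e v (i, false))
  have hE : Fintype.card E = ∏ v, (2 * m v).factorial := by
    rw [Fintype.card_pi]
    refine prod_congr rfl fun v _ => ?_
    have hc : Fintype.card (Fin (m v) × Bool) = Fintype.card (G.neighborSet v) := by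
      rw [G.card_neighborSet_eq_degree, hm]
      simp [mul_comm]
    rw [Fintype.card_equiv (Fintype.equivOfCardEq hc)]
    simp [mul_comm]
  have hEO : EO G = #{D : Digraph V | IsEulerianOrientation G D} := by
    rw [EO, Set.ncard_eq_toFinset_card', Set.toFinset_ofPred]
  rw [← hE, hEO, ← card_univ]
  -- Every pairing is compatible with some orientation, so a bound on the pairings compatible with
  -- one orientation bounds the number of orientations from below.
  have hcover : (univ : Finset E) ⊆
      ({D : Digraph V | IsEulerianOrientation G D} : Finset _).biUnion fun D => {e | P D e} := by
    intro e _
    obtain ⟨D, hD, hDe⟩ := exists_isEulerianOrientation_of_pairing G m e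
    simp only [mem_biUnion, mem_filter, mem_univ, true_and]
    exact ⟨D, hD, hDe⟩
  refine (card_le_card hcover).trans (card_biUnion_le_card_mul _ _ _ fun D hD => ?_)
  have hD : IsEulerianOrientation G D := by simpa using hD
  rw [← Fintype.card_subtype]
  have hpi : Fintype.card {e : E // P D e} = ∏ v, Fintype.card
      {e : (Fin (m v) × Bool) ≃ G.neighborSet v //
        ∀ i, D.Adj v (e (i, true)) ↔ ¬ D.Adj v (e (i, false))} := by
    rw [← Fintype.card_pi]
    exact Fintype.card_congr (Equiv.subtypePiEquivPi
      (p := fun v (f : (Fin (m v) × Bool) ≃ G.neighborSet v) =>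
        ∀ i, D.Adj v (f (i, true)) ↔ ¬ D.Adj v (f (i, false))))
  rw [hpi]
  refine prod_le_prod' fun v _ => ?_
  have hout := hD.card_out v
  rw [hm] at hout
  have h1 : Fintype.card {w : G.neighborSet v // D.Adj v w} = m v := by
    rw [show m v = #{w | D.Adj v w} by omega, ← Fintype.card_subtype]
    exact Fintype.card_congr ⟨fun w => ⟨w.1.1, w.2⟩,
      fun w => ⟨⟨w.1, hD.adj_of_arc _ _ w.2⟩, w.2⟩, fun _ => rfl, fun _ => rfl⟩
  refine card_splitting_enumerations_le (m v) (fun w : G.neighborSet v => D.Adj v w) h1 ?_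
  rw [Fintype.card_subtype_compl, h1, G.card_neighborSet_eq_degree, hm]
  omega

end EulerianOrientation

/-! ### Upper bound: sequential counting, random orderings, an average of binomial logarithms -/

/-- A set of sequences in which, given the previous terms, there are at most `c i` possibilities
for the `i`-th term has at most `∏ i, c i` elements. -/
theorem Finset.card_le_prod_of_card_next_le {β : Type*} [DecidableEq β] {n : ℕ}
    (A : Finset (Fin n → β)) (c : Fin n → ℕ)
    (h : ∀ i, ∀ a ∈ A, #({b ∈ A | ∀ j < i, b j = a j}.image fun b => b i) ≤ c i) :
    #A ≤ ∏ i, c i := by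
  classical
  induction n with
  | zero => simpa using card_le_univ A
  | succ n ih =>
    have hinit : ∀ (b : Fin (n + 1) → β) j, Fin.init b j = b j.castSucc := fun _ _ => rfl
    rw [Fin.prod_univ_castSucc, mul_comm]
    refine (card_le_mul_card_image (f := fun b : Fin (n + 1) → β => (Fin.init b : Fin n → β)) A
      (c (Fin.last n)) ?_).trans (Nat.mul_le_mul_left _ (ih _ _ ?_))
    · intro p hp
      obtain ⟨a, ha, rfl⟩ := mem_image.1 hp
      refine le_trans ?_ (h (Fin.last n) a ha)
      refine card_le_card_of_injOn (fun b => b (Fin.last n)) ?_ ?_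
      · intro b hb
        simp only [coe_filter, Set.mem_ofPred_eq] at hb
        refine mem_coe.2 (mem_image.2 ⟨b, mem_filter.2 ⟨hb.1, fun j hj => ?_⟩, rfl⟩)
        obtain ⟨j, rfl⟩ := Fin.exists_castSucc_eq.2 hj.ne
        exact congrFun hb.2 j
      · intro b hb b' hb' hbb
        simp only [coe_filter, Set.mem_ofPred_eq] at hb hb'
        rw [← Fin.snoc_init_self b, ← Fin.snoc_init_self b', hb.2, hb'.2]
        exact congrArg _ hbb
    · intro i p hp
      obtain ⟨a, ha, rfl⟩ := mem_image.1 hp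
      refine le_trans (card_le_card ?_) (h i.castSucc a ha)
      intro x hx
      simp only [mem_image, mem_filter] at hx ⊢
      obtain ⟨_, ⟨⟨b, hb, rfl⟩, hj⟩, rfl⟩ := hx
      refine ⟨b, ⟨hb, fun j hji => ?_⟩, rfl⟩
      obtain ⟨j, rfl⟩ := Fin.exists_castSucc_eq.2
        (hji.trans_le (Fin.le_last _)).ne
      exact hj j (by simpa using hji)

/-- In a random ordering of a finite type, the number of elements of a set `S` that come after a
given element of `S` is uniformly distributed. -/
theorem card_mul_sum_card_later {V : Type*} [Fintype V] [DecidableEq V] {n : ℕ} (S : Finset V)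
    {v : V} (hv : v ∈ S) (F : ℕ → ℝ) :
    (#S : ℝ) * ∑ e : V ≃ Fin n, F #{w ∈ S | e v < e w} =
      Fintype.card (V ≃ Fin n) * ∑ k ∈ range #S, F k := by
  -- For a fixed ordering, the elements of `S` have the distinct later-counts `0, ..., #S - 1`.
  have hrank : ∀ e : V ≃ Fin n, ∑ u ∈ S, F #{w ∈ S | e u < e w} = ∑ k ∈ range #S, F k := by
    intro e
    have hinj : Set.InjOn (fun u => #{w ∈ S | e u < e w}) S := by
      have hlt : ∀ x ∈ S, ∀ y ∈ S, e x < e y →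
          #{w ∈ S | e y < e w} < #{w ∈ S | e x < e w} := by
        intro x _ y hy hxy
        refine card_lt_card ⟨fun w hw => ?_, fun h => ?_⟩
        · simp only [mem_filter] at hw ⊢
          exact ⟨hw.1, hxy.trans hw.2⟩
        · exact lt_irrefl _ (mem_filter.1 (h (mem_filter.2 ⟨hy, hxy⟩))).2
      intro x hx y hy hxy
      by_contra hne
      rcases lt_or_gt_of_ne (e.injective.ne hne) with h | h
      · exact (hlt x hx y hy h).ne' hxy
      · exact (hlt y hy x hx h).ne hxy
    have himg : S.image (fun u => #{w ∈ S | e u < e w}) = range #S := by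
      refine eq_of_subset_of_card_le (fun k hk => ?_) ?_
      · obtain ⟨u, hu, rfl⟩ := mem_image.1 hk
        refine mem_range.2 (card_lt_card ⟨filter_subset _ _, fun h => ?_⟩)
        exact lt_irrefl _ (mem_filter.1 (h hu)).2
      · rw [card_range, card_image_of_injOn hinj]
    rw [← himg, sum_image hinj]
  -- Exchanging the positions of `u` and `v` permutes the orderings and preserves `S`, so every
  -- element of `S` contributes the same sum.
  have hsymm : ∀ u ∈ S, ∑ e : V ≃ Fin n, F #{w ∈ S | e u < e w} =
      ∑ e : V ≃ Fin n, F #{w ∈ S | e v < e w} := by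
    intro u hu
    refine Fintype.sum_equiv ((Equiv.swap u v).equivCongr (Equiv.refl _)) _ _ fun e => ?_
    congr 1
    refine card_bij (fun w _ => Equiv.swap u v w) ?_ ?_ ?_
    · intro w hw
      simp only [mem_filter, Equiv.equivCongr_apply_apply, Equiv.symm_swap, Equiv.swap_apply_right,
        Equiv.swap_apply_self, Equiv.refl_apply] at hw ⊢
      refine ⟨?_, hw.2⟩
      rw [Equiv.swap_apply_def]
      split_ifs
      exacts [hv, hu, hw.1]
    · exact fun _ _ _ _ h => (Equiv.swap u v).injective h
    · intro w hw
      refine ⟨Equiv.swap u v w, ?_, Equiv.swap_apply_self _ _ _⟩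
      simp only [mem_filter, Equiv.equivCongr_apply_apply, Equiv.symm_swap, Equiv.swap_apply_right,
        Equiv.refl_apply] at hw ⊢
      refine ⟨?_, hw.2⟩
      rw [Equiv.swap_apply_def]
      split_ifs
      exacts [hv, hu, hw.1]
  rw [← nsmul_eq_mul, ← sum_const, ← sum_congr rfl hsymm, sum_comm, sum_congr rfl fun e _ => hrank e,
    sum_const, card_univ, nsmul_eq_mul]

/-- Comparison of the average of `log (k.choose (k / 2))` over `k ≤ 2 * m` with its last term. -/
theorem sum_log_choose_half_le (m : ℕ) :
    ∑ k ∈ range (2 * m + 1), Real.log (k.choose (k / 2) : ℝ) ≤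
      (2 * m + 1) * (Real.log ((2 * m).choose m : ℝ) - m * Real.log 2 + Real.log 2) := by
  induction m with
  | zero => simpa using Real.log_nonneg (by norm_num : (1 : ℝ) ≤ 2)
  | succ m ih =>
    have hpos : (0 : ℝ) < (2 * m).choose m := by exact_mod_cast Nat.choose_pos (by omega)
    have hm : (0 : ℝ) ≤ m := m.cast_nonneg
    set b := Real.log ((2 * m).choose m : ℝ) with hb
    set L := Real.log ((2 * m + 2 : ℝ) / (2 * m + 1)) with hL
    have hodd : Real.log ((2 * m + 1).choose m : ℝ) = b + Real.log 2 - L := by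
      have h : ((2 * m + 1).choose m : ℝ) = (2 * m).choose m * 2 / ((2 * m + 2) / (2 * m + 1)) := by
        have := Nat.add_one_mul_choose_eq (2 * m) m
        rw [Nat.choose_symm_half] at this
        have : (2 * (m : ℝ) + 1) * (2 * m).choose m = (2 * m + 1).choose m * (m + 1) := by
          exact_mod_cast this
        field_simp
        linarith
      rw [h, Real.log_div (by positivity) (by positivity), Real.log_mul hpos.ne' two_ne_zero]
    have heven : Real.log ((2 * (m + 1)).choose (m + 1) : ℝ) = b + 2 * Real.log 2 - L := by
      have h : ((2 * (m + 1)).choose (m + 1) : ℝ) = 2 * (2 * m + 1).choose m := by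
        have : (2 * (m + 1)).choose (m + 1) = 2 * (2 * m + 1).choose m := by
          rw [show 2 * (m + 1) = 2 * m + 1 + 1 by ring, Nat.choose_succ_succ, Nat.choose_symm_half]
          ring
        exact_mod_cast this
      have hpos' : (0 : ℝ) < (2 * m + 1).choose m := by exact_mod_cast Nat.choose_pos (by omega)
      rw [h, Real.log_mul two_ne_zero hpos'.ne', hodd]
      ring
    -- After `hodd` and `heven` are inserted, the induction step reduces to `(2 * m + 1) * L ≤ 2 *
    -- log 2`; the bound `1` is enough because `2 * log 2 > 1`.
    have hLle : (2 * m + 1) * L ≤ 1 := by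
      have := Real.log_le_sub_one_of_pos (show (0 : ℝ) < (2 * m + 2) / (2 * m + 1) by positivity)
      calc (2 * m + 1) * L ≤ (2 * m + 1) * ((2 * m + 2 : ℝ) / (2 * m + 1) - 1) := by gcongr
        _ = 1 := by field_simp; ring
    have hlog := Real.log_two_gt_d9
    rw [show 2 * (m + 1) + 1 = 2 * m + 1 + 1 + 1 by ring, sum_range_succ, sum_range_succ,
      show (2 * m + 1 + 1) / 2 = m + 1 by omega, show (2 * m + 1) / 2 = m by omega,
      show 2 * m + 1 + 1 = 2 * (m + 1) by ring, hodd, heven]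
    push_cast
    nlinarith

/-! ### Upper bound: revealing an orientation along a vertex ordering -/

namespace EulerianOrientation

variable {V : Type u}

/-- Processing the vertices in any order, the number of Eulerian orientations is at most the product
of the middle binomial coefficients of the numbers of later neighbours. -/
theorem EO_le_prod_choose [Fintype V] [DecidableEq V] (G : SimpleGraph V) [DecidableRel G.Adj]
    {n : ℕ} (e : V ≃ Fin n) :
    EO G ≤ ∏ v, (#{w ∈ G.neighborFinset v | e v < e w}).choose
      (#{w ∈ G.neighborFinset v | e v < e w} / 2) := by
  classical
  have : Finite (Digraph V) := finite_digraph
  let : Fintype (Digraph V) := Fintype.ofFinite _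
  let code : Digraph V → Fin n → Finset V := fun D i => {w | D.Adj (e.symm i) w ∧ i < e w}
  let O : Finset (Digraph V) := {D | IsEulerianOrientation G D}
  have hmem : ∀ D, D ∈ O ↔ IsEulerianOrientation G D := fun D => by simp [O]
  have hEO : EO G = #O := by
    rw [EO, Set.ncard_eq_toFinset_card', Set.toFinset_ofPred]
  have hcode : ∀ (D : Digraph V) v w, e v < e w → (D.Adj v w ↔ w ∈ code D (e v)) := by
    intro D v w h
    simp [code, h]
  -- Arcs from `v` to earlier vertices can be read off from the codes of those vertices, since each
  -- edge has exactly one direction.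
  have hearlier : ∀ D ∈ O, ∀ D' ∈ O, ∀ v, (∀ j < e v, code D j = code D' j) →
      ∀ w, e w < e v → (D.Adj v w ↔ D'.Adj v w) := by
    intro D hD D' hD' v h w hw
    rw [((hmem D).1 hD).adj_iff w v, ((hmem D').1 hD').adj_iff w v, hcode D w v hw,
      hcode D' w v hw, h _ hw]
  have hloop : ∀ D ∈ O, ∀ v, ¬ D.Adj v v := fun D hD v h =>
    G.irrefl (((hmem D).1 hD).adj_of_arc v v h)
  have hinj : Set.InjOn code O := by
    intro D hD D' hD' h
    have hadj : D.Adj = D'.Adj := by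
      funext v w
      apply propext
      rcases lt_trichotomy (e v) (e w) with hvw | hvw | hvw
      · rw [hcode D v w hvw, hcode D' v w hvw, h]
      · obtain rfl := e.injective hvw
        exact iff_of_false (hloop D hD v) (hloop D' hD' v)
      · exact hearlier D hD D' hD' v (fun j _ => congrFun h j) w hvw
    cases D; cases D'; simpa using hadj
  -- The out-degree is half the degree, so the earlier codes fix the size of the code at `v`; the
  -- next term is then a subset of prescribed size.
  have hcount : ∀ D ∈ O, ∀ v, 2 * (#{w | D.Adj v w ∧ e w < e v} + #(code D (e v))) =
      G.degree v := by
    intro D hD v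
    rw [← ((hmem D).1 hD).card_out v, ← card_union_of_disjoint]
    · congr 2
      ext w
      have hne : D.Adj v w → e w ≠ e v := fun h h' => hloop D hD v (e.injective h' ▸ h)
      simp only [code, Equiv.symm_apply_apply, mem_union, mem_filter, mem_univ, true_and]
      constructor
      · tauto
      · intro h
        rcases lt_or_gt_of_ne (hne h) with h' | h'
        exacts [Or.inl ⟨h, h'⟩, Or.inr ⟨h, h'⟩]
    · rw [Finset.disjoint_left]
      intro w
      simp only [code, mem_filter, mem_univ, true_and]
      exact fun h h' => lt_asymm h.2 h'.2
  rw [hEO, ← card_image_of_injOn hinj, ← Equiv.prod_comp e.symm]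
  refine card_le_prod_of_card_next_le _ _ fun i a ha => ?_
  obtain ⟨D, hD, rfl⟩ := mem_image.1 ha
  obtain ⟨v, rfl⟩ := e.surjective i
  rw [Equiv.symm_apply_apply]
  refine le_trans (card_le_card (t := powersetCard #(code D (e v))
    {w ∈ G.neighborFinset v | e v < e w}) ?_) ?_
  · intro s hs
    simp only [mem_image, mem_filter] at hs
    obtain ⟨_, ⟨⟨D', hD', rfl⟩, hj⟩, rfl⟩ := hs
    rw [mem_powersetCard]
    constructor
    · intro w hw
      simp only [code, Equiv.symm_apply_apply, mem_filter, mem_univ, true_and] at hw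
      exact mem_filter.2 ⟨(G.mem_neighborFinset v w).2
        (((hmem D').1 hD').adj_of_arc v w hw.1), hw.2⟩
    · have h1 := hcount D hD v
      have h2 := hcount D' hD' v
      have h3 : ({w | D'.Adj v w ∧ e w < e v} : Finset V) =
          ({w | D.Adj v w ∧ e w < e v} : Finset V) :=
        filter_congr fun w _ => and_congr_left fun hw => hearlier D' hD' D hD v hj w hw
      rw [h3] at h2
      omega
  · rw [card_powersetCard]
    exact Nat.choose_le_middle _ _

/-- The upper bound for the residual entropy obtained by averaging over all vertex orderings. -/
theorem log_EO_le [Fintype V] (G : SimpleGraph V) [DecidableRel G.Adj] :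
    Real.log (EO G) ≤ ∑ v, (1 / ((G.degree v : ℝ) + 1)) *
      ∑ k ∈ range (G.degree v + 1), Real.log (k.choose (k / 2) : ℝ) := by
  classical
  set F : ℕ → ℝ := fun k => Real.log (k.choose (k / 2) : ℝ) with hF
  have hchoose : ∀ k : ℕ, 0 < k.choose (k / 2) := fun k => Nat.choose_pos (Nat.div_le_self _ _)
  let n := Fintype.card V
  have hbound : ∀ e : V ≃ Fin n, Real.log (EO G) ≤
      ∑ v, F #{w ∈ insert v (G.neighborFinset v) | e v < e w} := by
    intro e
    have h1 : (EO G : ℝ) ≤ ∏ v, ((#{w ∈ G.neighborFinset v | e v < e w}).choose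
        (#{w ∈ G.neighborFinset v | e v < e w} / 2) : ℝ) := by
      exact_mod_cast EO_le_prod_choose G e
    -- Inserting `v` leaves the count of later vertices unchanged, but makes the set contain `v`, as
    -- the uniform distribution of ranks requires; its size is `d + 1`.
    have hins : ∀ v, ({w ∈ insert v (G.neighborFinset v) | e v < e w} : Finset V) =
        {w ∈ G.neighborFinset v | e v < e w} := fun v => by
      rw [filter_insert, if_neg (lt_irrefl _)]
    simp only [hins, hF]
    rw [← Real.log_prod fun v _ => by exact_mod_cast (hchoose _).ne']
    -- The convention `Real.log 0 = 0` settles the case `EO G = 0`, so no existence result is needed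
    -- here.
    rcases Nat.eq_zero_or_pos (EO G) with h0 | h0
    · rw [h0, Nat.cast_zero, Real.log_zero]
      refine Real.log_nonneg ?_
      exact_mod_cast Nat.one_le_iff_ne_zero.2 (prod_ne_zero_iff.2 fun v _ => (hchoose _).ne')
    · exact Real.log_le_log (by exact_mod_cast h0) h1
  have hN : (0 : ℝ) < Fintype.card (V ≃ Fin n) := by
    have : Nonempty (V ≃ Fin n) := ⟨Fintype.equivFin V⟩
    exact_mod_cast Fintype.card_pos
  refine le_of_mul_le_mul_left ?_ hN
  calc (Fintype.card (V ≃ Fin n) : ℝ) * Real.log (EO G)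
      = ∑ _e : V ≃ Fin n, Real.log (EO G) := by rw [sum_const, card_univ, nsmul_eq_mul]
    _ ≤ ∑ e : V ≃ Fin n, ∑ v, F #{w ∈ insert v (G.neighborFinset v) | e v < e w} :=
      sum_le_sum fun e _ => hbound e
    _ = _ := by
      rw [sum_comm, mul_sum]
      refine sum_congr rfl fun v _ => ?_
      have h := card_mul_sum_card_later (n := n) (insert v (G.neighborFinset v))
        (mem_insert_self v _) F
      have hc : #(insert v (G.neighborFinset v)) = G.degree v + 1 := by
        rw [card_insert_of_notMem (by simp), G.card_neighborFinset_eq_degree]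
      rw [hc] at h
      push_cast at h
      have hd : ((G.degree v : ℝ) + 1) ≠ 0 := by positivity
      field_simp
      linarith

/-! ### Comparison with the Pauling estimate -/

theorem rho_le_pauling_add_log_two [Fintype V] [Nonempty V] (G : SimpleGraph V)
    [DecidableRel G.Adj] (hG : ∀ v, Even (G.degree v)) :
    rho G ≤ pauling G + Real.log 2 := by
  have hn : (0 : ℝ) < Fintype.card V := by exact_mod_cast Fintype.card_pos
  have key : Real.log (EO G) ≤ ∑ v, ((Real.log ((G.degree v).choose (G.degree v / 2) : ℝ)
      - (G.degree v : ℝ) / 2 * Real.log 2) + Real.log 2) := by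
    refine (log_EO_le G).trans (sum_le_sum fun v _ => ?_)
    obtain ⟨m, hm⟩ := (hG v).two_dvd
    have h := sum_log_choose_half_le m
    rw [hm, Nat.mul_div_cancel_left m two_pos, one_div, inv_mul_le_iff₀ (by positivity)]
    push_cast
    rwa [mul_div_cancel_left₀ _ (two_ne_zero' ℝ)]
  rw [sum_add_distrib, sum_const, card_univ, nsmul_eq_mul] at key
  rw [rho, pauling, one_div, inv_mul_le_iff₀ hn, mul_add, mul_inv_cancel_left₀ hn.ne']
  exact key

theorem pauling_le_rho [Fintype V] [Nonempty V] (G : SimpleGraph V)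
    [DecidableRel G.Adj] (hG : ∀ v, Even (G.degree v)) : pauling G ≤ rho G := by
  choose m hm using fun v => (hG v).two_dvd
  have hpos : ∀ v, (0 : ℝ) < 2 ^ m v * ((m v).factorial * (m v).factorial) := fun v => by positivity
  have hle : ∏ v, ((2 * m v).factorial : ℝ) ≤
      EO G * ∏ v, ((2 : ℝ) ^ m v * ((m v).factorial * (m v).factorial)) := by
    exact_mod_cast prod_factorial_le_EO_mul G m hm
  have hle' : ∏ v, ((2 * m v).factorial / (2 ^ m v * ((m v).factorial * (m v).factorial)) : ℝ) ≤
      EO G := by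
    rw [prod_div_distrib, div_le_iff₀ (prod_pos fun v _ => hpos v)]
    exact hle
  have hterm : ∀ v, Real.log ((2 * m v).factorial /
      (2 ^ m v * ((m v).factorial * (m v).factorial)) : ℝ) =
      Real.log ((G.degree v).choose (G.degree v / 2) : ℝ) - (G.degree v : ℝ) / 2 * Real.log 2 := by
    intro v
    have hc : ((2 * m v).choose (m v) : ℝ) =
        (2 * m v).factorial / ((m v).factorial * (m v).factorial) := by
      rw [Nat.cast_choose ℝ (by omega), show 2 * m v - m v = m v by omega]
    have hcpos : ((2 * m v).choose (m v) : ℝ) ≠ 0 := by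
      exact_mod_cast (Nat.choose_pos (by omega)).ne'
    rw [hm v, Nat.mul_div_cancel_left _ two_pos, mul_comm ((2 : ℝ) ^ m v), ← div_div, ← hc,
      Real.log_div hcpos (by positivity), Real.log_pow]
    push_cast
    ring
  have hlog := Real.log_le_log (prod_pos fun v _ => div_pos
    (by exact_mod_cast Nat.factorial_pos _) (hpos v)) hle'
  rw [Real.log_prod fun v _ => (div_pos (by exact_mod_cast Nat.factorial_pos _) (hpos v)).ne',
    sum_congr rfl fun v _ => hterm v] at hlog
  rw [rho, pauling]
  gcongr

end EulerianOrientation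

theorem corollaryC :
    (∀ (V : Type u) [Fintype V] [Nonempty V] (G : SimpleGraph V) [DecidableRel G.Adj],
      (∀ v : V, Even (G.degree v)) →
        EulerianOrientation.pauling G ≤ EulerianOrientation.rho G ∧
        EulerianOrientation.rho G ≤ EulerianOrientation.pauling G + 27 / 10 ∧
        ((∃ d : ℕ, G.IsRegularOfDegree d) →
          EulerianOrientation.rho G ≤ EulerianOrientation.pauling G + 21 / 22) ∧
        ((∃ d : ℕ, G.IsRegularOfDegree d) → G.CliqueFree 3 →
          EulerianOrientation.rho G ≤ EulerianOrientation.pauling G + 5 / 6)) ∧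
    (∃ C : ℝ, ∀ (V : Type u) [Fintype V] [Nonempty V] (G : SimpleGraph V) [DecidableRel G.Adj],
      (∀ v : V, Even (G.degree v)) → 2 ≤ G.minDegree →
        EulerianOrientation.pauling G ≤ EulerianOrientation.rho G ∧
        EulerianOrientation.rho G ≤ EulerianOrientation.pauling G + Real.log 2
          + C * (Real.log (G.minDegree : ℝ) ^ 2 / (G.minDegree : ℝ))) := by
  -- Here `5/6` is the smallest of the three constants, so the bound by `log 2` gives all of them
  -- without regularity or triangle-freeness. It also allows `C = 0` in the last claim.
  have hlog : Real.log 2 ≤ 5 / 6 := by linarith [Real.log_two_lt_d9]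
  refine ⟨fun V _ _ G _ hG => ?_, 0, fun V _ _ G _ hG _ => ?_⟩
  · have h := EulerianOrientation.rho_le_pauling_add_log_two G hG
    exact ⟨EulerianOrientation.pauling_le_rho G hG, by linarith, fun _ => by linarith,
      fun _ _ => by linarith⟩
  · rw [zero_mul, add_zero]
    exact ⟨EulerianOrientation.pauling_le_rho G hG,
      EulerianOrientation.rho_le_pauling_add_log_two G hG⟩
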